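/- Let $p\in[1,\infty)$ and let $(U,d)$ be a Polish metric space (a metric space whose topology is Polish, for instance a complete separable metric space). Let $\mathcal P_p(U)$ be the set of Borel probability measures $\mu$ on $U$ with $\int_U d(x,x_0)^p\,d\mu(x)<\infty$ for some $x_0\in U$. For Borel probability measures $\mu,\nu$ on $U$ put $$W_p(\mu,\nu)=\inf_{\gamma\in\Pi(\mu,\nu)}\Big(\int_{U\times U}d(x,y)^p\,d\gamma(x,y)\Big)^{1/p}\in[0,\infty],$$ where $\Pi(\mu,\nu)$ is the set of probability measures on $U\times U$ with first marginal $\mu$ and second marginal $\nu$; on $\mathcal P_p(U)$ this is a finite metric. Let $S$ be a Polish space, let $z\mapsto\mu_z$ be a map from $S$ to $\mathcal P_p(U)$ that is Borel measurable with respect to the topology of the metric $W_p$, let $V\subseteq S$ be a Borel set, let $\lambda$ be a Borel probability measure on $V$, and let $\nu\in\mathcal P_p(U)$. Let $\int_V\mu_z\,d\lambda(z)$ denote the mixture $B\mapsto\int_V\mu_z(B)\,d\lambda(z)$. Then $$W_p^p\Big(\int_V\mu_z\,d\lambda(z),\,\nu\Big)\le\int_V W_p^p(\mu_z,\nu)\,d\lambda(z),$$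 as an inequality in $[0,\infty]$. -/

import Mathlib

open MeasureTheory
open scoped ENNReal

namespace OptimalTransport

/-- The set `Π(μ, ν)` of couplings (transport plans): probability measures on `U × U` with
marginals `μ` and `ν`. -/
def couplings {U : Type*} [MeasurableSpace U] (μ ν : Measure U) : Set (Measure (U × U)) :=
  {γ | IsProbabilityMeasure γ ∧ γ.map Prod.fst = μ ∧ γ.map Prod.snd = ν}

/-- The `p`-Wasserstein distance `inf_{γ ∈ Π(μ, ν)} (∫ d(x, y)^p dγ(x, y))^{1/p}`, with values in
`[0, ∞]` (it is finite when both measures have finite `p`-th moments). -/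
noncomputable def wasserstein {U : Type*} [MetricSpace U] [MeasurableSpace U] (p : ℝ)
    (μ ν : Measure U) : ℝ≥0∞ :=
  ⨅ γ ∈ couplings μ ν, (∫⁻ x : U × U, edist x.1 x.2 ^ p ∂γ) ^ (1 / p)

/-- The Wasserstein space `𝒫_p(U)`: Borel probability measures on `U` with finite `p`-th moment. -/
structure WassersteinSpace (p : ℝ) (U : Type*) [MetricSpace U] [MeasurableSpace U] where
  toMeasure : Measure U
  isProbabilityMeasure : IsProbabilityMeasure toMeasure
  finite_moment : ∃ x₀ : U, ∫⁻ x, edist x x₀ ^ p ∂toMeasure < ∞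

/-- The topology of the metric `W_p` on `𝒫_p(U)`: a set is open if and only if it contains a
`W_p`-ball of positive radius around each of its points. -/
instance {p : ℝ} {U : Type*} [MetricSpace U] [MeasurableSpace U] :
    TopologicalSpace (WassersteinSpace p U) where
  IsOpen O := ∀ μ ∈ O, ∃ ε : ℝ≥0∞, 0 < ε ∧
    ∀ μ' : WassersteinSpace p U, wasserstein p μ.toMeasure μ'.toMeasure < ε → μ' ∈ O
  isOpen_univ := fun _ _ => ⟨1, one_pos, fun _ _ => Set.mem_univ _⟩
  isOpen_inter := by
    rintro A B hA hB μ ⟨hμA, hμB⟩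
    obtain ⟨a, ha, hA'⟩ := hA μ hμA
    obtain ⟨b, hb, hB'⟩ := hB μ hμB
    exact ⟨min a b, lt_min ha hb, fun μ' h =>
      ⟨hA' μ' (h.trans_le (min_le_left a b)), hB' μ' (h.trans_le (min_le_right a b))⟩⟩
  isOpen_sUnion := by
    rintro T hT μ ⟨A, hAT, hμA⟩
    obtain ⟨a, ha, hA'⟩ := hT A hAT μ hμA
    exact ⟨a, ha, fun μ' h => ⟨A, hAT, hA' μ' h⟩⟩

/-- `𝒫_p(U)` carries the Borel σ-algebra of the metric `W_p`. -/
instance {p : ℝ} {U : Type*} [MetricSpace U] [MeasurableSpace U] :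
    MeasurableSpace (WassersteinSpace p U) := borel _

instance {p : ℝ} {U : Type*} [MetricSpace U] [MeasurableSpace U] :
    BorelSpace (WassersteinSpace p U) := ⟨rfl⟩

end OptimalTransport

open Filter Topology

/-! If `z ↦ μ_z` took countably many values, near-optimal couplings of the `μ_z` with `ν` could be
chosen value by value, and their mixture would be a coupling of the mixture (`bind_mem_couplings`).
The general case is reduced to this one, with no measurable selection theorem.

Fix a countable π-system of open sets `B k` forming a basis. Stage `n` partitions the parameter
space into countably many cells on which `μ_z (B k)`, `k < n`, varies by at most `1 / n`, and
replaces `μ_z` by its value at one point per cell, chosen so that `∫ W_p^p(μ_z, ν) dλ` does not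
increase (`exists_section_lintegral_le`). The new mixtures converge weakly to the original one, and
by Prokhorov's theorem a bound on coupling costs survives the limit (`exists_coupling_of_tendsto`).
-/

namespace OptimalTransport

/-! ### Couplings and near-optimal plans -/

section Couplings

variable {U : Type*} [MetricSpace U] [MeasurableSpace U] {p : ℝ}

/-- Every coupling bounds the `p`-th power of the Wasserstein distance by its cost. -/
lemma wasserstein_rpow_le (hp : 0 < p) {μ ν : Measure U} {γ : Measure (U × U)}
    (hγ : γ ∈ couplings μ ν) :
    wasserstein p μ ν ^ p ≤ ∫⁻ x : U × U, edist x.1 x.2 ^ p ∂γ := by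
  have h : wasserstein p μ ν ≤ (∫⁻ x : U × U, edist x.1 x.2 ^ p ∂γ) ^ (1 / p) :=
    iInf₂_le γ hγ
  calc wasserstein p μ ν ^ p ≤ ((∫⁻ x : U × U, edist x.1 x.2 ^ p ∂γ) ^ (1 / p)) ^ p :=
        ENNReal.rpow_le_rpow h hp.le
    _ = _ := by rw [← ENNReal.rpow_mul, one_div_mul_cancel hp.ne', ENNReal.rpow_one]

lemma exists_coupling_of_wasserstein_lt {μ ν : Measure U} {c : ℝ≥0∞}
    (h : wasserstein p μ ν < c) :
    ∃ γ ∈ couplings μ ν, (∫⁻ x : U × U, edist x.1 x.2 ^ p ∂γ) ^ (1 / p) < c := by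
  simpa only [wasserstein, iInf_lt_iff, exists_prop] using h

lemma exists_coupling_of_wasserstein_rpow_lt (hp : 0 < p) {μ ν : Measure U} {c : ℝ≥0∞}
    (h : wasserstein p μ ν ^ p < c) :
    ∃ γ ∈ couplings μ ν, ∫⁻ x : U × U, edist x.1 x.2 ^ p ∂γ < c := by
  have h' : wasserstein p μ ν < c ^ (1 / p) := by
    rwa [one_div, ENNReal.lt_rpow_inv_iff hp]
  obtain ⟨γ, hγ, hlt⟩ := exists_coupling_of_wasserstein_lt h'
  exact ⟨γ, hγ, (ENNReal.rpow_lt_rpow_iff (one_div_pos.2 hp)).1 hlt⟩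

lemma exists_coupling_le_add (hp : 0 < p) (μ ν : Measure U) [IsProbabilityMeasure μ]
    [IsProbabilityMeasure ν] {ε : ℝ≥0∞} (hε : ε ≠ 0) :
    ∃ γ ∈ couplings μ ν, ∫⁻ x : U × U, edist x.1 x.2 ^ p ∂γ ≤ wasserstein p μ ν ^ p + ε := by
  by_cases h : wasserstein p μ ν ^ p = ∞
  -- The bound is infinite here, so any coupling will do.
  · exact ⟨μ.prod ν, ⟨inferInstance, by simp, by simp⟩, by simp [h]⟩
  · obtain ⟨γ, hγ, hlt⟩ := exists_coupling_of_wasserstein_rpow_lt hp (ENNReal.lt_add_right h hε)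
    exact ⟨γ, hγ, hlt.le⟩

end Couplings

/-- A mixture of couplings with a common second marginal is a coupling of the mixture. -/
lemma bind_mem_couplings {U Z : Type*} [MeasurableSpace U] [MeasurableSpace Z] {lam : Measure Z}
    [IsProbabilityMeasure lam] {μ : Z → Measure U} {ν : Measure U} {κ : Z → Measure (U × U)}
    (hμ : Measurable μ) (hκ : Measurable κ) (h : ∀ z, κ z ∈ couplings (μ z) ν) :
    lam.bind κ ∈ couplings (lam.bind μ) ν := by
  refine ⟨isProbabilityMeasure_bind hκ.aemeasurable (ae_of_all _ fun z => (h z).1), ?_, ?_⟩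
  · ext s hs
    rw [Measure.map_apply measurable_fst hs, Measure.bind_apply (measurable_fst hs) hκ.aemeasurable,
      Measure.bind_apply hs hμ.aemeasurable]
    refine lintegral_congr fun z => ?_
    rw [← Measure.map_apply measurable_fst hs, (h z).2.1]
  · ext s hs
    rw [Measure.map_apply measurable_snd hs, Measure.bind_apply (measurable_snd hs) hκ.aemeasurable]
    have : ∀ z, κ z (Prod.snd ⁻¹' s) = ν s := fun z => by
      rw [← Measure.map_apply measurable_snd hs, (h z).2.2]
    simp [this]

/-! ### Tightness and weak limits of couplings -/

/-- A weakly convergent sequence of probability measures on a Polish space is tight. -/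
lemma isTightMeasureSet_of_tendsto {U : Type*} [TopologicalSpace U] [PolishSpace U]
    [MeasurableSpace U] [BorelSpace U] {μs : ℕ → ProbabilityMeasure U} {μ : ProbabilityMeasure U}
    (h : Tendsto μs atTop (𝓝 μ)) :
    IsTightMeasureSet (Set.range fun n => (μs n : Measure U)) := by
  let _ := TopologicalSpace.upgradeIsCompletelyMetrizable U
  -- A convergent sequence together with its limit is compact, so the converse half of Prokhorov's
  -- theorem applies.
  have hc : IsCompact (insert μ (Set.range μs)) := h.isCompact_insert_range
  have ht := isTightMeasureSet_of_isCompact_closure (by rwa [hc.isClosed.closure_eq])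
  refine ht.subset ?_
  rintro _ ⟨n, rfl⟩
  exact ⟨μs n, Or.inr ⟨n, rfl⟩, rfl⟩

lemma isTightMeasureSet_singleton_of_polish {U : Type*} [TopologicalSpace U] [PolishSpace U]
    [MeasurableSpace U] [BorelSpace U] (ν : ProbabilityMeasure U) :
    IsTightMeasureSet {(ν : Measure U)} := by
  simpa using isTightMeasureSet_of_tendsto (tendsto_const_nhds (x := ν))

section Polish

variable {U : Type*} [MetricSpace U] [PolishSpace U] [MeasurableSpace U] [BorelSpace U] {p : ℝ}

/-- Couplings of bounded cost survive weak limits of the first marginal. -/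
lemma exists_coupling_of_tendsto (hp : 0 < p) {μs : ℕ → ProbabilityMeasure U}
    {μ ν : ProbabilityMeasure U} (h : Tendsto μs atTop (𝓝 μ)) {c : ℝ≥0∞}
    (hc : ∀ n, ∃ γ ∈ couplings (μs n : Measure U) ν, ∫⁻ x : U × U, edist x.1 x.2 ^ p ∂γ ≤ c) :
    ∃ γ ∈ couplings (μ : Measure U) ν, ∫⁻ x : U × U, edist x.1 x.2 ^ p ∂γ ≤ c := by
  choose γ hγ hγc using hc
  let Γ : ℕ → ProbabilityMeasure (U × U) := fun n => ⟨γ n, (hγ n).1⟩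
  -- Couplings are tight as soon as both families of marginals are.
  have ht : IsTightMeasureSet {((P : ProbabilityMeasure (U × U)) : Measure (U × U)) |
      P ∈ Set.range Γ} := by
    apply IsTightMeasureSet.prodMk
    · refine (isTightMeasureSet_of_tendsto h).subset ?_
      rintro _ ⟨_, ⟨_, ⟨n, rfl⟩, rfl⟩, rfl⟩
      exact ⟨n, (hγ n).2.1.symm⟩
    · refine (isTightMeasureSet_singleton_of_polish ν).subset ?_
      rintro _ ⟨_, ⟨_, ⟨n, rfl⟩, rfl⟩, rfl⟩
      exact (hγ n).2.2
  obtain ⟨Q, -, φ, hφ, hlim⟩ := (isCompact_closure_of_isTightMeasureSet ht).tendsto_subseq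
    (fun n => subset_closure (Set.mem_range_self n))
  refine ⟨Q, ⟨inferInstance, ?_, ?_⟩, ?_⟩
  · have h1 := ProbabilityMeasure.tendsto_map_of_tendsto_of_continuous (fun n => Γ (φ n)) Q hlim
      (continuous_fst (X := U) (Y := U))
    have h2 : (fun n => (Γ (φ n)).map (continuous_fst (X := U) (Y := U)).aemeasurable)
        = μs ∘ φ := by
      funext n
      exact Subtype.ext (hγ (φ n)).2.1
    rw [h2] at h1
    exact congrArg (fun P : ProbabilityMeasure U => (P : Measure U))
      (tendsto_nhds_unique h1 (h.comp hφ.tendsto_atTop))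
  · have h1 := ProbabilityMeasure.tendsto_map_of_tendsto_of_continuous (fun n => Γ (φ n)) Q hlim
      (continuous_snd (X := U) (Y := U))
    have h2 : (fun n => (Γ (φ n)).map (continuous_snd (X := U) (Y := U)).aemeasurable)
        = fun _ => ν := by
      funext n
      exact Subtype.ext (hγ (φ n)).2.2
    rw [h2] at h1
    exact congrArg (fun P : ProbabilityMeasure U => (P : Measure U))
      (tendsto_nhds_unique h1 tendsto_const_nhds)
  · have hf : ∀ x : U × U, edist x.1 x.2 ^ p = ENNReal.ofReal (dist x.1 x.2 ^ p) := fun x => by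
      rw [edist_dist, ENNReal.ofReal_rpow_of_nonneg dist_nonneg hp.le]
    have hcont : Continuous fun x : U × U => dist x.1 x.2 ^ p :=
      (continuous_fst.dist continuous_snd).rpow_const fun _ => Or.inr hp.le
    -- The cost is continuous and nonnegative but may be unbounded, so only a Fatou-type inequality
    -- is available; it suffices.
    have hl := lintegral_le_liminf_lintegral_of_forall_isOpen_measure_le_liminf_measure
      (μ := (Q : Measure (U × U))) (μs := fun n => (Γ (φ n) : Measure (U × U))) hcont
      (fun x => Real.rpow_nonneg dist_nonneg p)
      (fun G hG => ProbabilityMeasure.le_liminf_measure_open_of_tendsto hlim hG)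
    simp_rw [hf]
    refine hl.trans (liminf_le_of_frequently_le' (Frequently.of_forall fun n => ?_))
    exact (lintegral_congr fun x => (hf x).symm).trans_le (hγc (φ n))

/-- `W_p^p(·, ν)` is lower semicontinuous for weak convergence. -/
lemma lowerSemicontinuous_wasserstein_rpow (hp : 0 < p) (ν : ProbabilityMeasure U) :
    LowerSemicontinuous fun μ : ProbabilityMeasure U => wasserstein p (μ : Measure U) ν ^ p := by
  rw [lowerSemicontinuous_iff_isClosed_preimage]
  intro c
  refine IsSeqClosed.isClosed fun μs μ hμs h => ?_
  -- The slack `c' > c` provides couplings of cost below `c'` without assuming that the infimum is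
  -- attained.
  refine le_of_forall_gt_imp_ge_of_dense (α := ℝ≥0∞) fun c' hc' => ?_
  obtain ⟨γ, hγ, hle⟩ := exists_coupling_of_tendsto hp (ν := ν) (c := c') h fun n => by
    obtain ⟨γ, hγ, hlt⟩ := exists_coupling_of_wasserstein_rpow_lt hp ((hμs n).trans_lt hc')
    exact ⟨γ, hγ, hlt.le⟩
  exact (wasserstein_rpow_le hp hγ).trans hle

/-! ### The `W_p` topology against the weak topology -/

/-- Kantorovich's bound for the integrals of a bounded Lipschitz function. -/
lemma enorm_integral_sub_le (hp : 1 ≤ p) {μ ν : ProbabilityMeasure U} {γ : Measure (U × U)}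
    (hγ : γ ∈ couplings (μ : Measure U) ν) {f : U → ℝ} {L : NNReal}
    (hb : ∃ C, ∀ x y, dist (f x) (f y) ≤ C) (hf : LipschitzWith L f) :
    ‖∫ x, f x ∂(ν : Measure U) - ∫ x, f x ∂(μ : Measure U)‖ₑ ≤
      L * (∫⁻ x : U × U, edist x.1 x.2 ^ p ∂γ) ^ (1 / p) := by
  have := hγ.1
  let F : BoundedContinuousFunction U ℝ := BoundedContinuousFunction.mkOfBound ⟨f, hf.continuous⟩
    hb.choose hb.choose_spec
  have h1 : ∫ x, f x ∂(μ : Measure U) = ∫ x : U × U, f x.1 ∂γ := by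
    rw [← hγ.2.1, integral_map measurable_fst.aemeasurable
      hf.continuous.measurable.aestronglyMeasurable]
  have h2 : ∫ x, f x ∂(ν : Measure U) = ∫ x : U × U, f x.2 ∂γ := by
    rw [← hγ.2.2, integral_map measurable_snd.aemeasurable
      hf.continuous.measurable.aestronglyMeasurable]
  have i1 : Integrable (fun x : U × U => f x.1) γ :=
    (F.compContinuous ⟨Prod.fst, continuous_fst⟩).integrable γ
  have i2 : Integrable (fun x : U × U => f x.2) γ :=
    (F.compContinuous ⟨Prod.snd, continuous_snd⟩).integrable γ
  -- The `L^1` norm is at most the `L^p` norm for a probability measure; this is where `1 ≤ p`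
  -- enters.
  have hpow : ∫⁻ x : U × U, edist x.1 x.2 ∂γ ≤
      (∫⁻ x : U × U, edist x.1 x.2 ^ p ∂γ) ^ (1 / p) := by
    have h := eLpNorm'_le_eLpNorm'_of_exponent_le (μ := γ) (f := fun x : U × U => dist x.1 x.2)
      zero_lt_one hp
      (continuous_fst.dist continuous_snd).measurable.aestronglyMeasurable
    have he : ∀ x : U × U, ‖dist x.1 x.2‖ₑ = edist x.1 x.2 := fun x => by
      rw [Real.enorm_of_nonneg dist_nonneg, edist_dist]
    simpa [eLpNorm', he] using h
  calc ‖∫ x, f x ∂(ν : Measure U) - ∫ x, f x ∂(μ : Measure U)‖ₑ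
      = ‖∫ x : U × U, (f x.2 - f x.1) ∂γ‖ₑ := by rw [h1, h2, integral_sub i2 i1]
    _ ≤ ∫⁻ x : U × U, ‖f x.2 - f x.1‖ₑ ∂γ := enorm_integral_le_lintegral_enorm _
    _ ≤ ∫⁻ x : U × U, L * edist x.1 x.2 ∂γ := lintegral_mono fun x => by
        rw [← edist_eq_enorm_sub, edist_comm]
        exact hf x.1 x.2
    _ = L * ∫⁻ x : U × U, edist x.1 x.2 ∂γ := lintegral_const_mul _ measurable_edist
    _ ≤ _ := by gcongr

/-- Convergence in the Wasserstein distance implies weak convergence. -/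
lemma tendsto_of_tendsto_wasserstein (hp : 1 ≤ p) {μs : ℕ → ProbabilityMeasure U}
    {μ : ProbabilityMeasure U} {ε : ℕ → ℝ≥0∞} (hε : Tendsto ε atTop (𝓝 0))
    (h : ∀ n, wasserstein p (μ : Measure U) (μs n) < ε n) : Tendsto μs atTop (𝓝 μ) := by
  rw [tendsto_iff_forall_lipschitz_integral_tendsto]
  rintro f hb ⟨L, hL⟩
  rw [tendsto_iff_edist_tendsto_0]
  have hlim : Tendsto (fun n => (L : ℝ≥0∞) * ε n) atTop (𝓝 0) := by
    simpa using ENNReal.Tendsto.const_mul hε (Or.inr ENNReal.coe_ne_top)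
  refine tendsto_of_tendsto_of_tendsto_of_le_of_le tendsto_const_nhds hlim
    (fun _ => zero_le) fun n => ?_
  obtain ⟨γ, hγ, hlt⟩ := exists_coupling_of_wasserstein_lt (h n)
  rw [edist_eq_enorm_sub]
  exact (enorm_integral_sub_le hp hγ hb hL).trans (by gcongr)

/-- Forgetting the moment condition. -/
def WassersteinSpace.toProbabilityMeasure (μ : WassersteinSpace p U) : ProbabilityMeasure U :=
  ⟨μ.toMeasure, μ.isProbabilityMeasure⟩

/-- The topology of `W_p` is finer than the weak topology. -/
lemma continuous_toProbabilityMeasure (hp : 1 ≤ p) :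
    Continuous (WassersteinSpace.toProbabilityMeasure : WassersteinSpace p U → _) := by
  refine continuous_def.2 fun O hO μ hμ => ?_
  by_contra! hcon
  have hpos : ∀ n : ℕ, (0 : ℝ≥0∞) < ((n : ℝ≥0∞) + 1)⁻¹ := fun n => by simp
  choose μs hlt hnot using fun n : ℕ => hcon _ (hpos n)
  have hε : Tendsto (fun n : ℕ => ((n : ℝ≥0∞) + 1)⁻¹) atTop (𝓝 0) := by
    simpa using (tendsto_add_atTop_iff_nat 1).2 ENNReal.tendsto_inv_nat_nhds_zero
  have hlim := tendsto_of_tendsto_wasserstein hp (μ := μ.toProbabilityMeasure)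
    (μs := fun n => (μs n).toProbabilityMeasure) hε hlt
  obtain ⟨n, hn⟩ := (hlim.eventually (hO.mem_nhds hμ)).exists
  exact hnot n hn

/-- The identity from the Wasserstein space to the measures is measurable for the σ-algebra
generated by the evaluations. -/
lemma measurable_toMeasure (hp : 1 ≤ p) :
    Measurable (WassersteinSpace.toMeasure : WassersteinSpace p U → Measure U) := by
  have : ∀ μ : WassersteinSpace p U, IsProbabilityMeasure μ.toMeasure :=
    fun μ => μ.isProbabilityMeasure
  -- It is enough to evaluate on open sets, where evaluation is weakly lower semicontinuous.
  refine Measurable.measure_of_isPiSystem_of_isProbabilityMeasure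
    (BorelSpace.measurable_eq (α := U)) isPiSystem_isOpen fun G hG => ?_
  have hlsc : LowerSemicontinuous fun μ : ProbabilityMeasure U => (μ : Measure U) G := by
    rw [lowerSemicontinuous_iff_le_liminf]
    exact fun μ => ProbabilityMeasure.le_liminf_measure_open_of_tendsto tendsto_id hG
  exact (hlsc.comp (continuous_toProbabilityMeasure hp)).measurable

lemma measurable_wasserstein_rpow (hp : 1 ≤ p) (ν : ProbabilityMeasure U) :
    Measurable fun μ : WassersteinSpace p U => wasserstein p μ.toMeasure ν ^ p :=
  ((lowerSemicontinuous_wasserstein_rpow (zero_lt_one.trans_le hp) ν).comp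
    (continuous_toProbabilityMeasure hp)).measurable

end Polish

/-! ### Discretization of the parameter space -/

/-- From each cell of a countable measurable partition, a point can be chosen so that replacing
a function by its values at the chosen points does not increase its integral. -/
lemma exists_section_lintegral_le {Z T : Type*} [MeasurableSpace Z] [MeasurableSpace T]
    [Countable T] [MeasurableSingletonClass T] (lam : Measure Z) [IsProbabilityMeasure lam]
    {g : Z → T} (hg : Measurable g) {J : Z → ℝ≥0∞} (hJ : Measurable J) :
    ∃ s : T → Z, (∀ z, g (s (g z)) = g z) ∧ ∫⁻ z, J (s (g z)) ∂lam ≤ ∫⁻ z, J z ∂lam := by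
  have hm : ∀ t, MeasurableSet (g ⁻¹' {t}) := fun t => hg (measurableSet_singleton t)
  have key : ∀ t, ∃ z, ((g ⁻¹' {t}).Nonempty → g z = t) ∧
      J z * lam (g ⁻¹' {t}) ≤ ∫⁻ z in g ⁻¹' {t}, J z ∂lam := by
    intro t
    by_cases h0 : lam (g ⁻¹' {t}) = 0
    · by_cases hne : (g ⁻¹' {t}).Nonempty
      · exact ⟨hne.some, fun _ => hne.some_mem, by simp [h0]⟩
      · obtain ⟨z⟩ := lam.nonempty_of_neZero
        exact ⟨z, fun h => absurd h hne, by simp [h0]⟩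
    -- On a cell of positive measure, `J` is at most its average at some point.
    · obtain ⟨z, hz, hle⟩ := exists_le_setLAverage h0 (measure_ne_top _ _) hJ.aemeasurable.restrict
      refine ⟨z, fun _ => hz, ?_⟩
      rw [setLAverage_eq] at hle
      exact (ENNReal.le_div_iff_mul_le (Or.inl h0) (Or.inl (measure_ne_top _ _))).1 hle
  choose s hs hle using key
  refine ⟨s, fun z => hs _ ⟨z, rfl⟩, ?_⟩
  calc ∫⁻ z, J (s (g z)) ∂lam = ∫⁻ t, J (s t) ∂(lam.map g) :=
        (lintegral_map (f := fun t => J (s t)) Measurable.of_discrete hg).symm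
    _ = ∑' t, J (s t) * lam (g ⁻¹' {t}) := by
        rw [lintegral_countable']
        simp_rw [Measure.map_apply hg (measurableSet_singleton _)]
    _ ≤ ∑' t, ∫⁻ z in g ⁻¹' {t}, J z ∂lam := ENNReal.tsum_le_tsum hle
    _ = ∫⁻ z, J z ∂lam := by
        rw [← lintegral_iUnion hm (fun a b hab => Disjoint.preimage g (by simpa using hab)),
          ← Set.preimage_iUnion, Set.iUnion_of_singleton, Set.preimage_univ, setLIntegral_univ]

/-- The numbers `a k` for `k < n`, rounded down to multiples of `1 / n`. -/
noncomputable def discretize (n : ℕ) (a : ℕ → ℝ) : Fin n → ℤ := fun k => ⌊n * a k⌋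

lemma abs_sub_le_of_discretize_eq {n k : ℕ} (hk : k < n) {a b : ℕ → ℝ}
    (h : discretize n a = discretize n b) : |a k - b k| ≤ 1 / n := by
  have hn : (0 : ℝ) < n := by exact_mod_cast (Nat.zero_le k).trans_lt hk
  have h1 := Int.abs_sub_lt_one_of_floor_eq_floor (congrFun h ⟨k, hk⟩)
  rw [← mul_sub, abs_mul, abs_of_pos hn] at h1
  rw [le_div_iff₀' hn]
  exact h1.le

/-- A second countable space has a countable π-system of open sets which is a basis. -/
lemma exists_seq_isPiSystem_basis (U : Type*) [TopologicalSpace U] [SecondCountableTopology U] :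
    ∃ B : ℕ → Set U, IsPiSystem (Set.range B) ∧ (∀ k, IsOpen (B k)) ∧
      ∀ u : Set U, IsOpen u → ∀ x ∈ u, ∃ k, x ∈ B k ∧ B k ⊆ u := by
  -- Finite intersections of members of a countable basis stay countable in number and form a
  -- π-system.
  have hcount : (Set.sInter '' {F : Set (Set U) |
      F.Finite ∧ F ⊆ TopologicalSpace.countableBasis U}).Countable :=
    (Set.countable_ofPred_finite_subset (TopologicalSpace.countable_countableBasis U)).image _
  obtain ⟨B, hB⟩ := hcount.exists_eq_range ⟨_, ∅, ⟨Set.finite_empty, Set.empty_subset _⟩, rfl⟩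
  refine ⟨B, ?_, fun k => ?_, fun u hu x hx => ?_⟩
  · rw [← hB]
    rintro _ ⟨F, ⟨hF, hFs⟩, rfl⟩ _ ⟨G, ⟨hG, hGs⟩, rfl⟩ -
    exact ⟨F ∪ G, ⟨hF.union hG, Set.union_subset hFs hGs⟩, Set.sInter_union F G⟩
  · obtain ⟨F, ⟨hF, hFs⟩, hFk⟩ := hB.symm ▸ Set.mem_range_self (f := B) k
    rw [← hFk]
    exact hF.isOpen_sInter fun t ht => TopologicalSpace.isOpen_of_mem_countableBasis (hFs ht)
  · obtain ⟨v, hv, hxv, hvu⟩ :=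
      (TopologicalSpace.isBasis_countableBasis U).exists_subset_of_mem_open hx hu
    obtain ⟨k, hk⟩ : v ∈ Set.range B := hB ▸
      ⟨{v}, ⟨Set.finite_singleton v, Set.singleton_subset_iff.2 hv⟩, Set.sInter_singleton v⟩
    exact ⟨k, hk ▸ hxv, hk ▸ hvu⟩

/-! ### Mixtures -/

/-- The probability measure `∫ μ_z dλ(z)`. -/
noncomputable def mixture {U Z : Type*} [MeasurableSpace U] [MeasurableSpace Z] (lam : Measure Z)
    [IsProbabilityMeasure lam] (μ : Z → ProbabilityMeasure U)
    (hμ : Measurable fun z => (μ z : Measure U)) : ProbabilityMeasure U :=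
  ⟨lam.bind fun z => (μ z : Measure U),
    isProbabilityMeasure_bind hμ.aemeasurable (ae_of_all _ fun z => (μ z).2)⟩

lemma mixture_real {U Z : Type*} [MeasurableSpace U] [MeasurableSpace Z] {lam : Measure Z}
    [IsProbabilityMeasure lam] {μ : Z → ProbabilityMeasure U}
    (hμ : Measurable fun z => (μ z : Measure U)) {s : Set U} (hs : MeasurableSet s) :
    (mixture lam μ hμ : Measure U).real s = ∫ z, (μ z : Measure U).real s ∂lam := by
  have hm : Measurable fun z => (μ z : Measure U) s := (Measure.measurable_coe hs).comp hμ
  simp only [measureReal_def]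
  rw [integral_toReal hm.aemeasurable (ae_of_all _ fun z => measure_lt_top _ _)]
  congr 1
  exact Measure.bind_apply hs hμ.aemeasurable

/-- The Wasserstein distance of a measurable mixture, when `W_p^p(μ_z, ν)` depends measurably
on `z`. -/
lemma wasserstein_mixture_rpow_le {U Z : Type*} [MetricSpace U] [PolishSpace U]
    [MeasurableSpace U] [BorelSpace U] [MeasurableSpace Z] {p : ℝ} (hp : 0 < p) (lam : Measure Z)
    [IsProbabilityMeasure lam] {μ : Z → ProbabilityMeasure U}
    (hμ : Measurable fun z => (μ z : Measure U)) (ν : ProbabilityMeasure U)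
    (hJ : Measurable fun z => wasserstein p (μ z : Measure U) ν ^ p) :
    wasserstein p (mixture lam μ hμ : Measure U) ν ^ p ≤
      ∫⁻ z, wasserstein p (μ z : Measure U) ν ^ p ∂lam := by
  obtain ⟨B, hBpi, hBo, hB⟩ := exists_seq_isPiSystem_basis U
  let a : Z → ℕ → ℝ := fun z k => (μ z : Measure U).real (B k)
  have ha : ∀ k, Measurable fun z => a z k := fun k =>
    ((Measure.measurable_coe (hBo k).measurableSet).comp hμ).ennreal_toReal
  have hg : ∀ n, Measurable fun z => discretize n (a z) := fun n =>
    measurable_pi_lambda _ fun k => ((ha k).const_mul _).floor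
  choose s hsec hint using fun n => exists_section_lintegral_le lam (hg n) hJ
  -- Every function on the countable discrete space `Fin n → ℤ` is measurable, however `s n` was
  -- chosen.
  have hκ : ∀ n, Measurable fun z => (μ (s n (discretize n (a z))) : Measure U) := fun n =>
    (Measurable.of_discrete (f := fun t => (μ (s n t) : Measure U))).comp (hg n)
  have hlim : Tendsto (fun n => mixture lam (fun z => μ (s n (discretize n (a z)))) (hκ n)) atTop
      (𝓝 (mixture lam μ hμ)) := by
    refine hBpi.tendsto_probabilityMeasure_of_tendsto_of_mem ?_ ?_ ?_
    · rintro _ ⟨k, rfl⟩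
      exact (hBo k).measurableSet
    · intro u hu x hx
      obtain ⟨k, hxk, hku⟩ := hB u hu x hx
      exact ⟨B k, ⟨k, rfl⟩, (hBo k).mem_nhds hxk, hku⟩
    · rintro _ ⟨k, rfl⟩
      rw [← NNReal.tendsto_coe]
      simp only [← ProbabilityMeasure.measureReal_eq_coe_coeFn,
        mixture_real _ (hBo k).measurableSet]
      rw [tendsto_iff_norm_sub_tendsto_zero]
      have hbd : ∀ (ρ : Z → ProbabilityMeasure U), Measurable (fun z => (ρ z : Measure U)) →
          Integrable (fun z => (ρ z : Measure U).real (B k)) lam := fun ρ hρ =>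
        Integrable.of_bound (C := 1)
          ((Measure.measurable_coe (hBo k).measurableSet).comp
            hρ).ennreal_toReal.aestronglyMeasurable
          (ae_of_all _ fun z => by
            rw [Real.norm_of_nonneg measureReal_nonneg]
            exact measureReal_le_one)
      refine squeeze_zero' (Eventually.of_forall fun _ => norm_nonneg _) ?_
        tendsto_one_div_atTop_nhds_zero_nat
      -- Stage `n` controls `B k` only once `k < n`.
      filter_upwards [eventually_gt_atTop k] with n hn
      rw [← integral_sub (hbd _ (hκ n)) (hbd _ hμ)]
      have := norm_integral_le_of_norm_le_const (μ := lam) (C := 1 / (n : ℝ))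
        (f := fun z => (μ (s n (discretize n (a z))) : Measure U).real (B k) -
          (μ z : Measure U).real (B k))
        (ae_of_all _ fun z => abs_sub_le_of_discretize_eq hn (hsec n z))
      simpa using this
  refine ENNReal.le_of_forall_pos_le_add fun ε hε _ => ?_
  have hε' : (ε : ℝ≥0∞) ≠ 0 := by exact_mod_cast hε.ne'
  obtain ⟨γ, hγ, hle⟩ := exists_coupling_of_tendsto hp (ν := ν)
    (c := ∫⁻ z, wasserstein p (μ z : Measure U) ν ^ p ∂lam + ε) hlim fun n => by
      -- One `ε`-optimal coupling per cell, so measurability in `z` is again automatic.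
      choose γ hγ hle using fun t =>
        exists_coupling_le_add hp (μ (s n t) : Measure U) (ν : Measure U) hε'
      have hm : Measurable fun z => γ (discretize n (a z)) :=
        (Measurable.of_discrete (f := γ)).comp (hg n)
      refine ⟨_, bind_mem_couplings (hκ n) hm fun z => hγ _, ?_⟩
      rw [Measure.lintegral_bind hm.aemeasurable (measurable_edist.pow_const p).aemeasurable]
      calc _ ≤ ∫⁻ z, (wasserstein p (μ (s n (discretize n (a z))) : Measure U) ν ^ p + ε) ∂lam :=
            lintegral_mono fun z => hle _
        _ = ∫⁻ z, wasserstein p (μ (s n (discretize n (a z))) : Measure U) ν ^ p ∂lam + ε := by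
            rw [lintegral_add_right _ measurable_const, lintegral_const, measure_univ, mul_one]
        _ ≤ _ := add_le_add_left (hint n) _
  exact (wasserstein_rpow_le hp hγ).trans hle

end OptimalTransport

theorem mainTheorem5 {S U : Type*}
    [TopologicalSpace S] [PolishSpace S] [MeasurableSpace S] [BorelSpace S]
    [MetricSpace U] [PolishSpace U] [MeasurableSpace U] [BorelSpace U]
    (p : ℝ) (hp : 1 ≤ p)
    (μ : S → OptimalTransport.WassersteinSpace p U) (hμ : Measurable μ)
    (V : Set S) (hV : MeasurableSet V)
    (lam : Measure V) [IsProbabilityMeasure lam]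
    (ν : OptimalTransport.WassersteinSpace p U) :
    OptimalTransport.wasserstein p (lam.bind fun z : V => (μ z).toMeasure) ν.toMeasure ^ p ≤
      ∫⁻ z : V, OptimalTransport.wasserstein p (μ z).toMeasure ν.toMeasure ^ p ∂lam :=
  OptimalTransport.wasserstein_mixture_rpow_le (zero_lt_one.trans_le hp) lam
    (μ := fun z : V => (μ z).toProbabilityMeasure)
    ((OptimalTransport.measurable_toMeasure hp).comp (hμ.comp measurable_subtype_coe))
    ν.toProbabilityMeasure
    ((OptimalTransport.measurable_wasserstein_rpow hp ν.toProbabilityMeasure).comp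
      (hμ.comp measurable_subtype_coe))
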